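/- **Definitions.** All graphs are finite and simple, and $m\ge 1$. A \emph{cover} of a graph $G$ is a pair $\mathcal H=(L,H)$ of a graph $H$ and a function $L$ assigning to each vertex $u$ of $G$ a set $L(u)\subseteq V(H)$ such that (1) $\{L(u):u\in V(G)\}$ is a partition of $V(H)$ of size $|V(G)|$; (2) $H[L(u)]$ is complete for every $u\in V(G)$; (3) if $H$ has an edge between $L(u)$ and $L(v)$, then $u=v$ or $uv\in E(G)$; (4) if $uv\in E(G)$, then the edges of $H$ between $L(u)$ and $L(v)$ form a (possibly empty) matching. The cover is \emph{$m$-fold} if $|L(u)|=m$ for every $u\in V(G)$. An \emph{$\mathcal H$-coloring} of $G$ is an independent set of $H$ of size $|V(G)|$, and $P_{DP}(G,\mathcal H)$ is the number of $\mathcal H$-colorings of $G$. The \emph{DP color function} $P_{DP}(G,m)$ is the minimum of $P_{DP}(G,\mathcal H)$ over all $m$-fold covers $\mathcal H$ of $G$, and $P(G,m)$ denotes the chromatic polynomial, i.e. the number of proper colorings of $G$ with $m$ colors. $K_1\vee C_n$ is the join of a single vertex with the cycle $C_n$ on $n$ vertices. **Theorem.** For all integers $k\ge 1$ and $m\ge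 1$, $$P_{DP}(K_1\vee C_{2k+1},m)=P(K_1\vee C_{2k+1},m)$$ and $$P_{DP}(K_1\vee C_{2k+2},m)=\begin{cases}0 & \text{if } m\in\{1,2\},\\ 3 & \text{if } m=3,\\ P(K_1\vee C_{2k+2},m) & \text{if } m\ge 4.\end{cases}$$ -/

import Mathlib

namespace DPColor

universe u v

/-- The join `G ∨ H` of two vertex-disjoint graphs: the disjoint union of `G` and `H` together
with all edges between a vertex of `G` and a vertex of `H`. -/
def join {V : Type u} {W : Type v} (G : SimpleGraph V) (H : SimpleGraph W) :
    SimpleGraph (V ⊕ W) :=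
  SimpleGraph.sum G H ⊔ completeBipartiteGraph V W

/-- The cone `K₁ ∨ C_n` of the cycle on `n` vertices (a wheel, when `3 ≤ n`). -/
abbrev wheel (n : ℕ) : SimpleGraph (Fin 1 ⊕ Fin n) :=
  join (SimpleGraph.completeGraph (Fin 1)) (SimpleGraph.cycleGraph n)

/-- `P(G, m)`: the number of proper colorings of `G` with `m` colors. -/
noncomputable def chromaticPoly {V : Type u} (G : SimpleGraph V) (m : ℕ) : ℕ :=
  Nat.card (G.Coloring (Fin m))

/-- A cover `(L, H)` of a finite graph `G` (all graphs are finite). As the vertex set `X` of `H`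
is finite, taking it in `Type` covers every case up to isomorphism. -/
structure Cover {V : Type u} (G : SimpleGraph V) where
  /-- the vertex set of the graph `H` -/
  X : Type
  [fintypeX : Fintype X]
  /-- the graph `H` -/
  H : SimpleGraph X
  /-- the list of each vertex, a set of vertices of `H` -/
  L : V → Finset X
  /-- the lists form a partition of the vertex set of `H`: no list is empty, -/
  L_nonempty : ∀ u, (L u).Nonempty
  /-- and every vertex of `H` is in the list of exactly one `u` (so lists of distinct vertices are
  distinct and the partition has size `|V(G)|`) -/
  existsUnique_mem_L : ∀ x, ∃! u, x ∈ L u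
  /-- `H[L(u)]` is complete -/
  isClique_L : ∀ u, H.IsClique (L u : Set X)
  /-- if there is an edge of `H` between `L(u)` and `L(v)`, then `u = v` or `uv` is an edge -/
  eq_or_adj : ∀ u v, ∀ x ∈ L u, ∀ y ∈ L v, H.Adj x y → u = v ∨ G.Adj u v
  /-- if `uv` is an edge of `G`, then the edges of `H` between `L(u)` and `L(v)` form a matching,
  possibly empty: two of them that share an endpoint in either list are equal -/
  matching : ∀ u v, G.Adj u v → ∀ x ∈ L u, ∀ x' ∈ L u, ∀ y ∈ L v, ∀ y' ∈ L v,
    H.Adj x y → H.Adj x' y' → (x = x' ↔ y = y')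

/-- A cover is `m`-fold if every list has exactly `m` elements. -/
def Cover.IsFold {V : Type u} {G : SimpleGraph V} (C : Cover G) (m : ℕ) : Prop :=
  ∀ u, (C.L u).card = m

/-- `P_DP(G, 𝓗)`: the number of `𝓗`-colorings of `G`, that is, of independent sets of `H` of
size `|V(G)|`. -/
noncomputable def Cover.numColorings {V : Type u} [Fintype V] {G : SimpleGraph V}
    (C : Cover G) : ℕ :=
  {I : Finset C.X | C.H.IsNIndepSet (Fintype.card V) I}.ncard

/-- The DP color function `P_DP(G, m)`, `m ≥ 1`: the minimum of `P_DP(G, 𝓗)` over all `m`-fold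
covers `𝓗` of `G`. -/
noncomputable def dpColorFunction {V : Type u} [Fintype V] (G : SimpleGraph V) (m : ℕ) : ℕ :=
  sInf {n | ∃ C : Cover G, C.IsFold m ∧ C.numColorings = n}

/-- Every finite graph has an `m`-fold cover when `m ≥ 1`. -/
theorem exists_isFold {V : Type u} [Fintype V] (G : SimpleGraph V) {m : ℕ} (hm : 1 ≤ m) :
    ∃ C : Cover G, C.IsFold m := by
  classical
  let e := Fintype.equivFin V
  refine ⟨{ X := Fin (Fintype.card V) × Fin m
            H := SimpleGraph.fromRel (fun x y => x.1 = y.1)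
            L := fun u => Finset.univ.filter (fun x => x.1 = e u)
            L_nonempty := fun u => ⟨(e u, ⟨0, hm⟩), by simp⟩
            existsUnique_mem_L := fun x => ⟨e.symm x.1, by simp, by
              intro u hu
              simp only [Finset.mem_filter, Finset.mem_univ, true_and] at hu
              simp [hu]⟩
            isClique_L := ?_
            eq_or_adj := ?_
            matching := ?_ }, ?_⟩
  · intro u x hx y hy hxy
    simp only [Finset.mem_coe, Finset.mem_filter, Finset.mem_univ, true_and] at hx hy
    simp [SimpleGraph.fromRel_adj, hxy, hx, hy]
  · intro u v x hx y hy h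
    simp only [Finset.mem_filter, Finset.mem_univ, true_and] at hx hy
    simp only [SimpleGraph.fromRel_adj, hx, hy, e.apply_eq_iff_eq] at h
    exact Or.inl (h.2.elim id Eq.symm)
  · intro u v huv x hx x' _ y hy y' _ h
    simp only [Finset.mem_filter, Finset.mem_univ, true_and] at hx hy
    simp only [SimpleGraph.fromRel_adj, hx, hy, e.apply_eq_iff_eq] at h
    exact absurd (h.2.elim id Eq.symm) huv.ne
  · intro u
    have h : (Finset.univ.filter
        (fun x : Fin (Fintype.card V) × Fin m => x.1 = e u)) = {e u} ×ˢ Finset.univ := by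
      ext ⟨a, b⟩
      simp [eq_comm]
    simp [h]

/-- For `m ≥ 1` the minimum that defines `P_DP(G, m)` exists. -/
theorem isLeast_dpColorFunction {V : Type u} [Fintype V] (G : SimpleGraph V) {m : ℕ}
    (hm : 1 ≤ m) :
    IsLeast {n | ∃ C : Cover G, C.IsFold m ∧ C.numColorings = n} (dpColorFunction G m) := by
  obtain ⟨C, hC⟩ := exists_isFold G hm
  exact ⟨Nat.sInf_mem ⟨_, C, hC, rfl⟩, fun _ hn => Nat.sInf_le hn⟩

end DPColor

namespace DPColor

/-! Completing matchings to bijections only destroys colorings, and relabelling makes all spokes the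
identity, so a cover of the wheel reduces to permutations `σ i` of the `m` colors on the `l + 1` rim
edges. Once the hub has color `c`, the rim is a cycle with matchings on `K = m - 1` colors. Products
of matrices `J - P` (all-ones minus permutation) have the form `A J ± P'`, so a cycle count depends
only on `A = walkCoeff K l` and the fixed points of the holonomy (`card_cycleColorings`).

On an odd rim (`l` even) fixed points lower the count, so the identity is optimal for each `c`
separately. On an even rim fixed points raise it, and a twist can save up to `K` per hub color. But
a color `c` moved by some `σ i` leaves that edge's matching on the other colors one pair short,
which gains `A`. A color fixed by every `σ i` forces fixed points of the holonomy for other hub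
colors. Summed over `c`, the gains compensate exactly when `A = K`. Since `A ≥ K` for `m ≥ 4`, the
identity is again optimal. For `m = 3`, `A = 1` and the bound drops to 3, attained by a 3-cycle on
one rim edge. -/

/-- A matching between finite types of equal size extends to a bijection. -/
theorem exists_equiv_of_matching {A B : Type*} [Fintype A] [Fintype B]
    (h : Fintype.card A = Fintype.card B) (R : A → B → Prop)
    (hR : ∀ x x' y y', R x y → R x' y' → (x = x' ↔ y = y')) :
    ∃ e : A ≃ B, ∀ x y, R x y → e x = y := by
  classical
  rcases isEmpty_or_nonempty B with hB | ⟨⟨b⟩⟩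
  · exact ⟨Fintype.equivOfCardEq h, fun _ y => isEmptyElim y⟩
  -- The default `b` is harmless: the extension below agrees with `f` only on the domain of `R`.
  let f : A → B := fun x => if hx : ∃ y, R x y then hx.choose else b
  have hf : ∀ x y, R x y → f x = y := by
    intro x y hxy
    have hx : ∃ y, R x y := ⟨y, hxy⟩
    simp only [f, dif_pos hx]
    exact (hR _ _ _ _ hx.choose_spec hxy).1 rfl
  obtain ⟨g, hg⟩ := Finset.exists_equiv_extend_of_card_eq (α := A) (β := B) (t := Finset.univ)
    (by simpa using h) (s := Finset.univ.filter fun x => ∃ y, R x y) (f := f) (by simp) (by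
      intro x hx x' hx' hxx
      simp only [Finset.coe_filter, Finset.mem_univ, true_and, Set.mem_ofPred_eq] at hx hx'
      obtain ⟨y, hy⟩ := hx
      obtain ⟨y', hy'⟩ := hx'
      rw [hf x y hy, hf x' y' hy'] at hxx
      exact (hR _ _ _ _ hy hy').2 hxx)
  refine ⟨g.trans (Equiv.subtypeUnivEquiv (by simp)), fun x y hxy => ?_⟩
  have := hg x (by simpa using ⟨y, hxy⟩)
  simpa [hf x y hxy] using this

/-! ### Transfer matrices for paths and cycles -/

section Transfer

variable {α : Type*}

/-- The common off-target value of the number of walks of length `l` in a twisted complete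
graph on `K` colors. -/
def walkCoeff (K : ℤ) : ℕ → ℤ
  | 0 => 0
  | l + 1 => (K - 1) * walkCoeff K l + (-1) ^ l

/-- The composition of the first `l` permutations of a sequence. -/
def holonomy (τ : ℕ → Equiv.Perm α) : ℕ → Equiv.Perm α
  | 0 => 1
  | l + 1 => τ l * holonomy τ l

theorem holonomy_apply_eq_self {τ : ℕ → Equiv.Perm α} {p : α} {l : ℕ}
    (h : ∀ j < l, τ j p = p) : holonomy τ l p = p := by
  induction l with
  | zero => rfl
  | succ l ih =>
    rw [holonomy, Equiv.Perm.mul_apply, ih fun j hj => h j (by omega), h l (by omega)]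

variable [Fintype α] [DecidableEq α]

/-- Sequences of colors from `p` to `q` that avoid the matchings given by `τ`. -/
def pathColorings (τ : ℕ → Equiv.Perm α) (l : ℕ) (p q : α) : Finset (Fin (l + 1) → α) :=
  {a | a 0 = p ∧ a (Fin.last l) = q ∧ ∀ j : Fin l, a j.succ ≠ τ j (a j.castSucc)}

theorem card_pathColorings_succ (τ : ℕ → Equiv.Perm α) (l : ℕ) (p q : α) :
    (pathColorings τ (l + 1) p q).card =
      ∑ r with q ≠ τ l r, (pathColorings τ l p r).card := by
  have h : (pathColorings τ (l + 1) p q).card =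
      (({r | q ≠ τ l r} : Finset α).sigma fun r => pathColorings τ l p r).card := by
    refine Finset.card_bij' (fun a _ => ⟨a (Fin.last l).castSucc, Fin.init a⟩)
      (fun s _ => Fin.snoc (α := fun _ => α) s.2 q) ?_ ?_ ?_ ?_
    · intro a ha
      simp only [pathColorings, Finset.mem_filter, Finset.mem_univ, true_and,
        Finset.mem_sigma] at ha ⊢
      obtain ⟨h0, h1, h2⟩ := ha
      refine ⟨?_, h0, rfl, fun j => ?_⟩
      · have := h2 (Fin.last l)
        simpa [← h1] using this
      · simpa [Fin.init] using h2 j.castSucc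
    · rintro ⟨r, a⟩ ha
      simp only [pathColorings, Finset.mem_filter, Finset.mem_univ, true_and,
        Finset.mem_sigma] at ha ⊢
      obtain ⟨hr, h0, h1, h2⟩ := ha
      refine ⟨?_, by simp, fun j => ?_⟩
      · rw [← Fin.castSucc_zero, Fin.snoc_castSucc]; exact h0
      · refine Fin.lastCases ?_ (fun j => ?_) j
        · simpa [h1] using hr
        · rw [Fin.succ_castSucc, Fin.snoc_castSucc, Fin.snoc_castSucc]
          exact h2 j
    · intro a ha
      simp only [pathColorings, Finset.mem_filter, Finset.mem_univ, true_and] at ha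
      simp only [← ha.2.1]
      exact Fin.snoc_init_self a
    · rintro ⟨r, a⟩ ha
      simp only [pathColorings, Finset.mem_filter, Finset.mem_univ, true_and,
        Finset.mem_sigma] at ha
      simp [ha.2.2.1]
  rw [h, Finset.card_sigma]

/-- This is the entry of a product of matrices `J - P`: since `J² = K J` and `J P = P J = J`, only a
multiple of `J` and the signed product of the `P`s survive. -/
theorem card_pathColorings (τ : ℕ → Equiv.Perm α) (l : ℕ) (p q : α) :
    ((pathColorings τ l p q).card : ℤ) =
      walkCoeff (Fintype.card α) l + (-1) ^ l * if holonomy τ l p = q then 1 else 0 := by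
  induction l generalizing q with
  | zero =>
    by_cases h : p = q
    · subst h
      rw [if_pos (show holonomy τ 0 p = p from rfl), walkCoeff, pow_zero, one_mul,
        zero_add (1 : ℤ), Nat.cast_eq_one, Finset.card_eq_one]
      refine ⟨fun _ => p, ?_⟩
      ext a
      simp only [pathColorings, Finset.mem_filter, Finset.mem_univ, true_and,
        Finset.mem_singleton]
      constructor
      · rintro ⟨h, -⟩
        funext i
        rw [show i = 0 from Fin.ext (by omega), h]
      · rintro rfl
        exact ⟨rfl, rfl, fun j => j.elim0⟩
    · rw [if_neg (show ¬holonomy τ 0 p = q from h), walkCoeff, mul_zero, zero_add (0 : ℤ),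
        Nat.cast_eq_zero, Finset.card_eq_zero, Finset.eq_empty_iff_forall_notMem]
      intro a ha
      simp only [pathColorings, Finset.mem_filter, Finset.mem_univ, true_and] at ha
      exact h (ha.1.symm.trans ha.2.1)
  | succ l ih =>
    have hq : ({r | q ≠ τ l r} : Finset α) = Finset.univ.erase ((τ l)⁻¹ q) := by
      ext r
      rw [Finset.mem_filter, Finset.mem_erase, ne_eq, ne_eq, Equiv.Perm.eq_inv_iff_eq]
      simp [eq_comm]
    have hc : holonomy τ (l + 1) p = q ↔ holonomy τ l p = (τ l)⁻¹ q := by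
      rw [Equiv.Perm.eq_inv_iff_eq, holonomy, Equiv.Perm.mul_apply]
    rw [card_pathColorings_succ, hq, Nat.cast_sum, Finset.sum_erase_eq_sub (Finset.mem_univ _)]
    simp only [ih, hc, Finset.sum_add_distrib, ← Finset.mul_sum, Finset.sum_ite_eq,
      Finset.mem_univ, if_true, Finset.sum_const, Finset.card_univ, walkCoeff, nsmul_eq_mul]
    ring

/-- The number of colorings of a cycle whose last matching is defined on `D` only. -/
theorem card_cycleColorings (τ : ℕ → Equiv.Perm α) (ρ : Equiv.Perm α) (D : Finset α) (l : ℕ) :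
    (({a : Fin (l + 1) → α | (∀ j : Fin l, a j.succ ≠ τ j (a j.castSucc)) ∧
        (a (Fin.last l) ∈ D → a 0 ≠ ρ (a (Fin.last l)))} : Finset _).card : ℤ) =
      (Fintype.card α ^ 2 - D.card) * walkCoeff (Fintype.card α) l +
        (-1) ^ l * (Fintype.card α - ({q ∈ D | holonomy τ l (ρ q) = q} : Finset α).card) := by
  have h : ({a : Fin (l + 1) → α | (∀ j : Fin l, a j.succ ≠ τ j (a j.castSucc)) ∧
        (a (Fin.last l) ∈ D → a 0 ≠ ρ (a (Fin.last l)))} : Finset _).card =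
      ∑ q, ∑ p, if q ∈ D ∧ p = ρ q then 0 else (pathColorings τ l p q).card := by
    rw [Finset.card_eq_sum_card_fiberwise (f := fun a => a (Fin.last l)) (t := Finset.univ)
      (by simp)]
    refine Finset.sum_congr rfl fun q _ => ?_
    rw [Finset.card_eq_sum_card_fiberwise (f := fun a => a 0) (t := Finset.univ) (by simp)]
    refine Finset.sum_congr rfl fun p _ => ?_
    split_ifs with hpq
    · rw [Finset.card_eq_zero, Finset.eq_empty_iff_forall_notMem]
      intro a ha
      simp only [Finset.mem_filter, Finset.mem_univ, true_and] at ha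
      obtain ⟨⟨⟨-, h1⟩, rfl⟩, rfl⟩ := ha
      exact h1 hpq.1 hpq.2
    · congr 1
      ext a
      simp only [pathColorings, Finset.mem_filter, Finset.mem_univ, true_and]
      constructor
      · rintro ⟨⟨⟨h0, -⟩, h2⟩, h3⟩
        exact ⟨h3, h2, h0⟩
      · rintro ⟨rfl, rfl, h0⟩
        exact ⟨⟨⟨h0, fun h h' => hpq ⟨h, h'⟩⟩, rfl⟩, rfl⟩
  -- All pairs of endpoints are counted, then the pairs `(ρ q, q)` with `q ∈ D` are removed.
  have h2 : ∀ q p, ((if q ∈ D ∧ p = ρ q then 0 else (pathColorings τ l p q).card : ℕ) : ℤ) =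
      (pathColorings τ l p q).card -
        if p = ρ q then (if q ∈ D then ((pathColorings τ l (ρ q) q).card : ℤ) else 0) else 0 := by
    intro q p
    by_cases hp : p = ρ q <;> by_cases hq : q ∈ D <;> simp [hp, hq]
  have h3 : ∀ q, (∑ p, if holonomy τ l p = q then (1 : ℤ) else 0) = 1 := by
    intro q
    rw [Finset.sum_eq_single ((holonomy τ l)⁻¹ q)]
    · simp
    · intro p _ hp
      rw [if_neg]
      rintro rfl
      simp at hp
    · simp
  rw [h]
  simp only [Nat.cast_sum, h2, Finset.sum_sub_distrib, Finset.sum_ite_eq',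
    Finset.mem_univ, if_true, card_pathColorings, Finset.sum_add_distrib, ← Finset.mul_sum, h3,
    Finset.sum_const, Finset.card_univ, nsmul_eq_mul, Finset.sum_ite_mem, Finset.univ_inter,
    Finset.card_filter, Nat.cast_ite, Nat.cast_one, Nat.cast_zero]
  ring

end Transfer
end DPColor
namespace DPColor

/-! ### Estimates for the walk coefficient -/

theorem mul_walkCoeff (K : ℤ) (l : ℕ) : K * walkCoeff K l = (K - 1) ^ l - (-1) ^ l := by
  induction l with
  | zero => simp [walkCoeff]
  | succ l ih =>
    rw [walkCoeff]
    linear_combination (K - 1) * ih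

theorem walkCoeff_nonneg {K : ℤ} (hK : 2 ≤ K) {l : ℕ} (hl : Odd l) : 0 ≤ walkCoeff K l := by
  have h := mul_walkCoeff K l
  rw [hl.neg_one_pow] at h
  have h1 : 0 ≤ (K - 1) ^ l := pow_nonneg (by linarith) l
  nlinarith

theorem walkCoeff_two {l : ℕ} (hl : Odd l) : walkCoeff 2 l = 1 := by
  have h := mul_walkCoeff 2 l
  rw [hl.neg_one_pow] at h
  norm_num at h
  linarith

theorem le_walkCoeff {K : ℤ} (hK : 3 ≤ K) {l : ℕ} (hl : Odd l) (h3 : 3 ≤ l) :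
    K ≤ walkCoeff K l := by
  have h := mul_walkCoeff K l
  rw [hl.neg_one_pow] at h
  have h1 : (K - 1) ^ 3 ≤ (K - 1) ^ l := pow_le_pow_right₀ (by linarith) h3
  have h2 : K * K ≤ K * walkCoeff K l := by
    -- The difference of the two sides is at least `(K - 1)^3 + 1 - K^2 = K (K - 1) (K - 3)`, up to
    -- the order of the factors.
    rw [h]
    nlinarith [mul_nonneg (by linarith : 0 ≤ K) (mul_nonneg (by linarith : 0 ≤ K - 3)
      (by linarith : 0 ≤ K - 1))]
  exact le_of_mul_le_mul_left h2 (by linarith)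

/-! ### Counting colorings of twisted wheels -/

variable {α : Type*} [Fintype α] [DecidableEq α] {l : ℕ}

/-- Colorings of the rim of a twisted wheel that are compatible with the color `c` of the hub. -/
def rimColorings (σ : Fin (l + 1) → Equiv.Perm α) (c : α) :
    Finset (Fin (l + 1) → {x : α // x ≠ c}) :=
  {a | ∀ i, (a (i + 1)).1 ≠ σ i (a i).1}

/-- The number of colorings of a twisted wheel. -/
def wheelCount (σ : Fin (l + 1) → Equiv.Perm α) : ℕ := ∑ c, (rimColorings σ c).card

theorem card_rimColorings_rotate (σ : Fin (l + 1) → Equiv.Perm α) (c : α) (d : Fin (l + 1)) :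
    (rimColorings (fun i => σ (i + d)) c).card = (rimColorings σ c).card := by
  refine Finset.card_bij' (fun a _ i => a (i - d)) (fun a _ i => a (i + d)) ?_ ?_ ?_ ?_
  · intro a ha
    simp only [rimColorings, Finset.mem_filter, Finset.mem_univ, true_and] at ha ⊢
    intro i
    have := ha (i - d)
    rwa [sub_add_cancel, sub_add_eq_add_sub] at this
  · intro a ha
    simp only [rimColorings, Finset.mem_filter, Finset.mem_univ, true_and] at ha ⊢
    intro i
    have := ha (i + d)
    rwa [add_right_comm] at this
  · intro a _
    simp
  · intro a _
    simp

theorem forall_fin_cyclic {P : Fin (l + 1) → Fin (l + 1) → Prop} :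
    (∀ i, P i (i + 1)) ↔ (∀ j : Fin l, P j.castSucc j.succ) ∧ P (Fin.last l) 0 := by
  constructor
  · intro h
    refine ⟨fun j => ?_, ?_⟩
    · simpa using h j.castSucc
    · simpa using h (Fin.last l)
  · rintro ⟨h, h'⟩ i
    refine Fin.lastCases ?_ (fun j => ?_) i
    · simpa using h'
    · simpa using h j

theorem card_ne (c : α) : (Fintype.card {x : α // x ≠ c} : ℤ) = Fintype.card α - 1 := by
  rw [Fintype.card_subtype_compl, Fintype.card_subtype_eq,
    Nat.cast_sub (Fintype.card_pos_iff.2 ⟨c⟩), Nat.cast_one]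

theorem card_rimColorings_one (c : α) :
    ((rimColorings (1 : Fin (l + 1) → Equiv.Perm α) c).card : ℤ) =
      (Fintype.card α - 1) * (Fintype.card α - 2) * walkCoeff (Fintype.card α - 1) l := by
  have h := card_cycleColorings (α := {x : α // x ≠ c}) (fun _ => 1) 1 Finset.univ l
  have h1 : ({q ∈ (Finset.univ : Finset {x : α // x ≠ c}) |
      holonomy (fun _ => 1) l ((1 : Equiv.Perm {x : α // x ≠ c}) q) = q} : Finset _) =
      Finset.univ := by
    rw [Finset.filter_eq_self]
    intro q _
    exact holonomy_apply_eq_self fun _ _ => rfl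
  rw [h1, Finset.card_univ, card_ne] at h
  have h2 : rimColorings (1 : Fin (l + 1) → Equiv.Perm α) c =
      ({a : Fin (l + 1) → {x : α // x ≠ c} |
        (∀ j : Fin l, a j.succ ≠ (1 : Equiv.Perm {x : α // x ≠ c}) (a j.castSucc)) ∧
        (a (Fin.last l) ∈ (Finset.univ : Finset {x : α // x ≠ c}) →
          a 0 ≠ (1 : Equiv.Perm {x : α // x ≠ c}) (a (Fin.last l)))} : Finset _) := by
    ext a
    simp only [rimColorings, Finset.mem_filter, Finset.mem_univ, true_and, true_imp_iff]
    rw [forall_fin_cyclic (P := fun i i' => (a i').1 ≠ (1 : Fin (l + 1) → Equiv.Perm α) i (a i).1)]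
    simp [Subtype.ext_iff]
  rw [h2, h]
  ring

theorem wheelCount_one : (wheelCount (1 : Fin (l + 1) → Equiv.Perm α) : ℤ) = Fintype.card α *
      ((Fintype.card α - 1) * (Fintype.card α - 2) * walkCoeff (Fintype.card α - 1) l) := by
  simp [wheelCount, card_rimColorings_one]

/-- A lower bound for the number of rim colorings in terms of bijective completions of the
matchings induced on the colors other than `c`. -/
theorem exists_le_card_rimColorings (σ : Fin (l + 1) → Equiv.Perm α) (c : α)
    (D : Finset {x : α // x ≠ c}) (hD : ∀ x, σ (Fin.last l) x.1 ≠ c → x ∈ D) :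
    ∃ F : Finset {x : α // x ≠ c}, F ⊆ D ∧
      (∀ x ∈ D, (∀ i, σ i x.1 = x.1) → x ∈ F) ∧
      ((Fintype.card α - 1) ^ 2 - D.card) * walkCoeff (Fintype.card α - 1) l +
        (-1) ^ l * ((Fintype.card α - 1) - F.card) ≤ ((rimColorings σ c).card : ℤ) := by
  have hτ : ∀ i, ∃ τ : Equiv.Perm {x : α // x ≠ c}, ∀ x y, σ i x.1 = y.1 → τ x = y := fun i =>
    exists_equiv_of_matching rfl (fun x y : {x : α // x ≠ c} => σ i x.1 = y.1) (by
      intro x x' y y' h h'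
      rw [Subtype.ext_iff, Subtype.ext_iff, ← h, ← h', (σ i).apply_eq_iff_eq])
  choose τ hτ using hτ
  -- Only indices below `l` matter, so `Fin.ofNat` never wraps around.
  have h := card_cycleColorings (fun j => τ (Fin.ofNat (l + 1) j)) (τ (Fin.last l)) D l
  rw [card_ne] at h
  refine ⟨_, Finset.filter_subset _ _, ?_, h.symm.le.trans ?_⟩
  · intro x hx hfix
    have hf : ∀ i, τ i x = x := fun i => hτ i x x (hfix i)
    rw [Finset.mem_filter, hf]
    exact ⟨hx, holonomy_apply_eq_self fun j _ => hf _⟩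
  · rw [Nat.cast_le]
    refine Finset.card_le_card fun a ha => ?_
    simp only [rimColorings, Finset.mem_filter, Finset.mem_univ, true_and] at ha ⊢
    rw [forall_fin_cyclic (P := fun i i' => (a i').1 ≠ σ i (a i).1)]
    -- If the last color is outside `D`, then `σ (Fin.last l)` sends it to `c`, which `a 0` avoids
    -- anyway.
    refine ⟨fun j hj => ha.1 j ?_, fun h0 => ha.2 (hD _ ?_) ?_⟩
    · have : Fin.ofNat (l + 1) (j : ℕ) = j.castSucc :=
        Fin.ext (by simp)
      rw [this]
      exact (hτ _ _ _ hj.symm).symm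
    · rw [← h0]
      exact (a 0).2
    · exact (hτ _ _ _ h0.symm).symm

/-- The sign is positive, so the worst case is a holonomy that fixes every color. -/
theorem le_card_rimColorings_of_even (hl : Even l) (σ : Fin (l + 1) → Equiv.Perm α) (c : α) :
    (Fintype.card α - 1) * (Fintype.card α - 2) * walkCoeff (Fintype.card α - 1) l ≤
      ((rimColorings σ c).card : ℤ) := by
  obtain ⟨F, -, -, h⟩ := exists_le_card_rimColorings σ c Finset.univ (by simp)
  have hF : (F.card : ℤ) ≤ Fintype.card {x : α // x ≠ c} := by exact_mod_cast F.card_le_univ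
  rw [Finset.card_univ, hl.neg_one_pow] at h
  rw [card_ne] at h hF
  linarith

theorem wheelCount_one_le_of_even (hl : Even l) (σ : Fin (l + 1) → Equiv.Perm α) :
    wheelCount (1 : Fin (l + 1) → Equiv.Perm α) ≤ wheelCount σ := by
  refine Finset.sum_le_sum fun c _ => ?_
  have := le_card_rimColorings_of_even hl σ c
  rw [← card_rimColorings_one (l := l) c] at this
  exact_mod_cast this

/-- The colors fixed by every permutation of a family. -/
def fixedColors (σ : Fin (l + 1) → Equiv.Perm α) : Finset α := {p | ∀ i, σ i p = p}

/-- Every globally fixed color other than `c` is a fixed point of the holonomy and adds one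
coloring. -/
theorem le_card_rimColorings_of_mem (hl : Odd l) (σ : Fin (l + 1) → Equiv.Perm α) {c : α}
    (hc : c ∈ fixedColors σ) :
    (Fintype.card α - 1) * (Fintype.card α - 2) * walkCoeff (Fintype.card α - 1) l -
      (Fintype.card α - 1) + ((fixedColors σ).card - 1) ≤ ((rimColorings σ c).card : ℤ) := by
  obtain ⟨F, -, hfix, h⟩ := exists_le_card_rimColorings σ c Finset.univ (by simp)
  have hF : ((fixedColors σ).erase c).card ≤ F.card := by
    rw [← Finset.card_map ⟨Subtype.val, Subtype.val_injective⟩ (s := F)]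
    refine Finset.card_le_card fun x hx => ?_
    rw [Finset.mem_erase, fixedColors, Finset.mem_filter] at hx
    rw [Finset.mem_map]
    exact ⟨⟨x, hx.1⟩, hfix _ (Finset.mem_univ _) hx.2.2, rfl⟩
  have hF' : ((fixedColors σ).card : ℤ) - 1 ≤ F.card := by
    rw [Finset.card_erase_of_mem hc] at hF
    omega
  rw [Finset.card_univ, hl.neg_one_pow, card_ne] at h
  linarith

/-- Rotating the rim puts an edge that moves `c` last. There the color sent to `c` has no partner,
so `D` loses an element and one `walkCoeff` is gained. -/
theorem le_card_rimColorings_of_notMem (hα : 3 ≤ Fintype.card α) (hl : Odd l)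
    (σ : Fin (l + 1) → Equiv.Perm α) {c : α} (hc : c ∉ fixedColors σ) :
    (Fintype.card α - 1) * (Fintype.card α - 2) * walkCoeff (Fintype.card α - 1) l -
      (Fintype.card α - 1) + (walkCoeff (Fintype.card α - 1) l + (fixedColors σ).card) ≤
        ((rimColorings σ c).card : ℤ) := by
  obtain ⟨i, hi⟩ : ∃ i, σ i c ≠ c := by simpa [fixedColors] using hc
  rw [← card_rimColorings_rotate σ c (i + 1)]
  have hlast : σ (Fin.last l + (i + 1)) = σ i := by
    rw [add_comm i 1, ← add_assoc, Fin.last_add_one, zero_add]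
  obtain ⟨F, -, hfix, h⟩ := exists_le_card_rimColorings (fun j => σ (j + (i + 1))) c
    {x | σ i x.1 ≠ c} (by
      intro x hx
      rw [hlast] at hx
      simpa using hx)
  have hF : (fixedColors σ).card ≤ F.card := by
    rw [← Finset.card_map ⟨Subtype.val, Subtype.val_injective⟩ (s := F)]
    refine Finset.card_le_card fun x hx => ?_
    have hxc : x ≠ c := by
      rintro rfl
      exact hc hx
    rw [fixedColors, Finset.mem_filter] at hx
    rw [Finset.mem_map]
    refine ⟨⟨x, hxc⟩, hfix _ ?_ fun j => hx.2 _, rfl⟩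
    simpa [hx.2 i] using hxc
  have hD : (({x : {x : α // x ≠ c} | σ i x.1 ≠ c} : Finset _).card : ℤ) ≤
      Fintype.card α - 2 := by
    have : ({x : {x : α // x ≠ c} | σ i x.1 ≠ c} : Finset _).card <
        (Finset.univ : Finset {x : α // x ≠ c}).card := by
      refine Finset.card_lt_card (Finset.filter_ssubset.2
        ⟨⟨(σ i)⁻¹ c, fun h => hi ?_⟩, Finset.mem_univ _, ?_⟩)
      · rw [Equiv.Perm.inv_eq_iff_eq] at h
        exact h.symm
      · rw [not_not]
        exact (σ i).apply_symm_apply c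
    have h2 := card_ne c
    rw [Finset.card_univ] at this
    omega
  have hF' : ((fixedColors σ).card : ℤ) ≤ F.card := by exact_mod_cast hF
  have hA := walkCoeff_nonneg (K := Fintype.card α - 1) (by
    have : (3 : ℤ) ≤ Fintype.card α := by exact_mod_cast hα
    linarith) hl
  rw [hl.neg_one_pow] at h
  nlinarith [mul_le_mul_of_nonneg_right hD hA]

theorem le_wheelCount_of_odd (hα : 3 ≤ Fintype.card α) (hl : Odd l)
    (σ : Fin (l + 1) → Equiv.Perm α) :
    Fintype.card α * ((Fintype.card α - 1) * (Fintype.card α - 2) *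
      walkCoeff (Fintype.card α - 1) l - (Fintype.card α - 1)) +
      (fixedColors σ).card * ((fixedColors σ).card - 1) +
      (Fintype.card α - (fixedColors σ).card) *
        (walkCoeff (Fintype.card α - 1) l + (fixedColors σ).card) ≤ (wheelCount σ : ℤ) := by
  have h1 := Finset.card_nsmul_le_sum (fixedColors σ)
    (fun c => ((rimColorings σ c).card : ℤ)) _ fun c hc => le_card_rimColorings_of_mem hl σ hc
  have h2 := Finset.card_nsmul_le_sum (fixedColors σ)ᶜ
    (fun c => ((rimColorings σ c).card : ℤ)) _ fun c hc =>
      le_card_rimColorings_of_notMem hα hl σ (Finset.mem_compl.1 hc)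
  rw [wheelCount, Nat.cast_sum, ← Finset.sum_add_sum_compl (fixedColors σ)]
  rw [nsmul_eq_mul] at h1 h2
  rw [Finset.card_compl, Nat.cast_sub (Finset.card_le_univ _)] at h2
  linarith

theorem wheelCount_one_le_of_odd (hα : 4 ≤ Fintype.card α) (hl : Odd l) (h3 : 3 ≤ l)
    (σ : Fin (l + 1) → Equiv.Perm α) :
    wheelCount (1 : Fin (l + 1) → Equiv.Perm α) ≤ wheelCount σ := by
  have h := le_wheelCount_of_odd (by omega) hl σ
  have hα' : (4 : ℤ) ≤ Fintype.card α := by exact_mod_cast hα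
  have hA := le_walkCoeff (K := Fintype.card α - 1) (by linarith) hl h3
  have hg : ((fixedColors σ).card : ℤ) ≤ Fintype.card α := by
    exact_mod_cast Finset.card_le_univ _
  rw [← Nat.cast_le (α := ℤ), wheelCount_one]
  -- With `m` colors, `g` of them fixed, the surplus of the lower bound is `g (g - 1) + (m - g) (A +
  -- g) - m (m - 1) = (m - g) (A - (m - 1))`.
  nlinarith [mul_nonneg (sub_nonneg.2 hg) (sub_nonneg.2 hA)]

theorem three_le_wheelCount (hα : Fintype.card α = 3) (hl : Odd l)
    (σ : Fin (l + 1) → Equiv.Perm α) : 3 ≤ wheelCount σ := by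
  have h := le_wheelCount_of_odd hα.ge hl σ
  rw [hα] at h
  norm_num [walkCoeff_two hl] at h
  rw [← Nat.cast_le (α := ℤ)]
  push_cast
  -- For three colors, `g` of them fixed, the bound simplifies to `3 + g`.
  nlinarith

end DPColor
namespace DPColor

universe u

/-! ### From covers to colorings and back -/

section Cover

variable {V : Type u} [Fintype V] {G : SimpleGraph V}

theorem card_le_numColorings (C : Cover G) {ι : Type*} [Fintype ι] (F : ι → V → C.X)
    (hinj : Function.Injective F) (hL : ∀ x u, F x u ∈ C.L u)
    (hadj : ∀ x u v, G.Adj u v → ¬C.H.Adj (F x u) (F x v)) :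
    Fintype.card ι ≤ C.numColorings := by
  classical
  have := C.fintypeX
  have hu : ∀ x y u v, F x u = F y v → u = v := fun x y u v h =>
    (C.existsUnique_mem_L (F x u)).unique (hL x u) (h ▸ hL y v)
  have hF : Function.Injective fun x => Finset.univ.image (F x) := by
    intro x y hxy
    refine hinj (funext fun u => ?_)
    have h : F x u ∈ Finset.univ.image (F y) := by
      rw [← show Finset.univ.image (F x) = Finset.univ.image (F y) from hxy]
      exact Finset.mem_image_of_mem _ (Finset.mem_univ u)
    obtain ⟨v, -, hv⟩ := Finset.mem_image.1 h
    rw [← hv, hu _ _ _ _ hv]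
  rw [← Nat.card_eq_fintype_card, ← Set.ncard_range_of_injective hF]
  refine Set.ncard_le_ncard ?_ (Set.toFinite _)
  rintro _ ⟨x, rfl⟩
  refine ⟨?_, ?_⟩
  · intro a ha b hb hab h
    simp only [Finset.coe_image, Finset.coe_univ, Set.image_univ, Set.mem_range] at ha hb
    obtain ⟨u, rfl⟩ := ha
    obtain ⟨v, rfl⟩ := hb
    rcases C.eq_or_adj u v _ (hL x u) _ (hL x v) h with rfl | huv
    · exact hab rfl
    · exact hadj x u v huv h
  · rw [Finset.card_image_of_injective _ fun u v h => hu x x u v h, Finset.card_univ]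

end Cover

section TwistedCover

variable {V : Type} [Fintype V] [DecidableEq V] {m : ℕ}

/-- The cover in which the lists of adjacent vertices `u`, `v` are matched by `ρ u v`. -/
def twistedCover (G : SimpleGraph V) (ρ : V → V → Equiv.Perm (Fin m))
    (hρ : ∀ u v, ρ v u = (ρ u v)⁻¹) (hm : 1 ≤ m) : Cover G where
  X := V × Fin m
  H :=
    { Adj := fun x y => (x.1 = y.1 ∧ x.2 ≠ y.2) ∨ (G.Adj x.1 y.1 ∧ y.2 = ρ x.1 y.1 x.2)
      symm := ⟨by
        rintro x y (h | h)
        · exact Or.inl ⟨h.1.symm, h.2.symm⟩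
        · refine Or.inr ⟨h.1.symm, ?_⟩
          rw [hρ x.1 y.1, Equiv.Perm.eq_inv_iff_eq]
          exact h.2.symm⟩
      loopless := ⟨by
        rintro x (h | h)
        · exact h.2 rfl
        · exact h.1.ne rfl⟩ }
  L := fun u => Finset.univ.filter fun x => x.1 = u
  L_nonempty := fun u => ⟨(u, ⟨0, hm⟩), by simp⟩
  existsUnique_mem_L := fun x => ⟨x.1, by simp, by
    intro u hu
    simpa [eq_comm] using hu⟩
  isClique_L := by
    intro u x hx y hy hxy
    simp only [Finset.coe_filter, Finset.mem_univ, true_and, Set.mem_ofPred_eq] at hx hy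
    exact Or.inl ⟨hx.trans hy.symm, fun h => hxy (Prod.ext (hx.trans hy.symm) h)⟩
  eq_or_adj := by
    intro u v x hx y hy h
    simp only [Finset.mem_filter, Finset.mem_univ, true_and] at hx hy
    subst hx hy
    exact h.imp And.left And.left
  matching := by
    intro u v huv x hx x' hx' y hy y' hy' h h'
    simp only [Finset.mem_filter, Finset.mem_univ, true_and] at hx hx' hy hy'
    have hy2 := (h.resolve_left fun h => huv.ne (by rw [← hx, ← hy, h.1])).2
    have hy2' := (h'.resolve_left fun h => huv.ne (by rw [← hx', ← hy', h.1])).2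
    rw [hx, hy] at hy2
    rw [hx', hy'] at hy2'
    rw [Prod.ext_iff, Prod.ext_iff, hx, hx', hy, hy', hy2, hy2', (ρ u v).apply_eq_iff_eq]
    simp

theorem twistedCover_isFold (G : SimpleGraph V) (ρ : V → V → Equiv.Perm (Fin m))
    (hρ : ∀ u v, ρ v u = (ρ u v)⁻¹) (hm : 1 ≤ m) : (twistedCover G ρ hρ hm).IsFold m := by
  intro u
  change (Finset.univ.filter fun x : V × Fin m => x.1 = u).card = m
  have h : (Finset.univ.filter fun x : V × Fin m => x.1 = u) = {u} ×ˢ Finset.univ := by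
    ext ⟨a, b⟩
    simp [eq_comm]
  simp [h]

theorem numColorings_twistedCover_le (G : SimpleGraph V) (ρ : V → V → Equiv.Perm (Fin m))
    (hρ : ∀ u v, ρ v u = (ρ u v)⁻¹) (hm : 1 ≤ m) :
    (twistedCover G ρ hρ hm).numColorings ≤
      Nat.card {f : V → Fin m // ∀ u v, G.Adj u v → f v ≠ ρ u v (f u)} := by
  let F : {f : V → Fin m // ∀ u v, G.Adj u v → f v ≠ ρ u v (f u)} → Finset (V × Fin m) :=
    fun f => Finset.univ.image fun u => (u, f.1 u)
  have hsub : {I : Finset (V × Fin m) |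
      (twistedCover G ρ hρ hm).H.IsNIndepSet (Fintype.card V) I} ⊆ Set.range F := by
    -- Lists are cliques, so `I` meets each at most once; having `|V|` elements, it meets each
    -- exactly once.
    rintro I ⟨hI, hcard⟩
    have hinj : Set.InjOn Prod.fst (I : Set (V × Fin m)) := by
      intro x hx y hy hxy
      by_contra hne
      exact hI hx hy hne (Or.inl ⟨hxy, fun h => hne (Prod.ext hxy h)⟩)
    have himg : I.image Prod.fst = Finset.univ := by
      rw [← Finset.card_eq_iff_eq_univ]
      exact (Finset.card_image_of_injOn hinj).trans hcard
    have hex : ∀ u, ∃ c, (u, c) ∈ I := by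
      intro u
      have hu : u ∈ I.image Prod.fst := himg ▸ Finset.mem_univ u
      obtain ⟨⟨_, c⟩, hc, rfl⟩ := Finset.mem_image.1 hu
      exact ⟨c, hc⟩
    choose f hf using hex
    refine ⟨⟨f, fun u v huv h => hI (hf u) (hf v) ?_ (Or.inr ⟨huv, h⟩)⟩, ?_⟩
    · exact fun h => huv.ne (congrArg Prod.fst h)
    · ext ⟨u, c⟩
      simp only [F, Finset.mem_image, Finset.mem_univ, true_and]
      constructor
      · rintro ⟨v, hv⟩
        rw [← hv]
        exact hf v
      · intro h
        exact ⟨u, hinj (hf u) h rfl⟩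
  have hfin : (Set.range F).Finite := Set.toFinite _
  calc (twistedCover G ρ hρ hm).numColorings ≤ (Set.range F).ncard :=
        Set.ncard_le_ncard hsub hfin
    _ ≤ _ := by
        rw [← Set.image_univ]
        exact (Set.ncard_image_le (Set.toFinite _)).trans (Set.ncard_univ _).le

theorem dpColorFunction_le_card (G : SimpleGraph V) (ρ : V → V → Equiv.Perm (Fin m))
    (hρ : ∀ u v, ρ v u = (ρ u v)⁻¹) (hm : 1 ≤ m) :
    dpColorFunction G m ≤ Nat.card {f : V → Fin m // ∀ u v, G.Adj u v → f v ≠ ρ u v (f u)} :=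
  ((isLeast_dpColorFunction G hm).2 ⟨_, twistedCover_isFold G ρ hρ hm, rfl⟩).trans
    (numColorings_twistedCover_le G ρ hρ hm)

theorem dpColorFunction_le_chromaticPoly (G : SimpleGraph V) (hm : 1 ≤ m) :
    dpColorFunction G m ≤ chromaticPoly G m := by
  refine (dpColorFunction_le_card G (fun _ _ => (1 : Equiv.Perm (Fin m))) (by simp) hm).trans ?_
  exact Nat.card_le_card_of_injective
    (fun f => SimpleGraph.Coloring.mk f.1 fun {u v} huv h => f.2 u v huv h.symm)
    fun f g h => Subtype.ext (funext fun v => DFunLike.congr_fun h v)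

end TwistedCover

/-! ### The DP color function of wheels -/

section Wheel

variable {l m : ℕ}

theorem cycleGraph_adj_iff (hl : 1 ≤ l) {i j : Fin (l + 1)} :
    (SimpleGraph.cycleGraph (l + 1)).Adj i j ↔ j = i + 1 ∨ i = j + 1 := by
  obtain ⟨r, rfl⟩ := Nat.exists_eq_add_of_le' hl
  rw [SimpleGraph.cycleGraph_adj, sub_eq_iff_eq_add', sub_eq_iff_eq_add', or_comm]

theorem wheel_adj_hub {n : ℕ} (i : Fin n) (h : Fin 1) :
    (wheel n).Adj (Sum.inl h) (Sum.inr i) := by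
  simp [wheel, join]

theorem wheel_adj_rim {n : ℕ} {i j : Fin n} :
    (wheel n).Adj (Sum.inr i) (Sum.inr j) ↔ (SimpleGraph.cycleGraph n).Adj i j := by
  simp [wheel, join]

theorem wheel_not_adj_inl {n : ℕ} (h h' : Fin 1) :
    ¬(wheel n).Adj (Sum.inl h) (Sum.inl h') := by
  rw [Subsingleton.elim h h']
  exact SimpleGraph.irrefl _

/-- The hub list is transported along the completed spoke matchings to label every rim list, so the
hub color is forbidden under the same name everywhere on the rim. -/
theorem exists_wheelCount_le (hl : 1 ≤ l) (C : Cover (wheel (l + 1))) (hC : C.IsFold m) :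
    ∃ σ : Fin (l + 1) → Equiv.Perm (Fin m), wheelCount σ ≤ C.numColorings := by
  have hcard : ∀ u, Fintype.card (Fin m) = Fintype.card (C.L u) := by
    intro u
    rw [Fintype.card_fin, Fintype.card_coe, hC u]
  let e₀ : Fin m ≃ C.L (Sum.inl 0) := Fintype.equivOfCardEq (hcard _)
  have he : ∀ i, ∃ e : Fin m ≃ C.L (Sum.inr i),
      ∀ c y, C.H.Adj (e₀ c).1 y.1 → e c = y := fun i =>
    exists_equiv_of_matching (hcard _) (fun c y => C.H.Adj (e₀ c).1 y.1) (by
      intro c c' y y' h h'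
      have := C.matching _ _ (wheel_adj_hub i 0) _ (e₀ c).2 _ (e₀ c').2 _ y.2 _ y'.2 h h'
      rwa [← Subtype.ext_iff, ← Subtype.ext_iff, e₀.apply_eq_iff_eq] at this)
  choose e he using he
  have hadj : ∀ i : Fin (l + 1), (wheel (l + 1)).Adj (Sum.inr i) (Sum.inr (i + 1)) :=
    fun i => wheel_adj_rim.2 ((cycleGraph_adj_iff hl).2 (Or.inl rfl))
  have hσ : ∀ i, ∃ σ : Equiv.Perm (Fin m),
      ∀ a b, C.H.Adj (e i a).1 (e (i + 1) b).1 → σ a = b := fun i =>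
    exists_equiv_of_matching rfl (fun a b => C.H.Adj (e i a).1 (e (i + 1) b).1) (by
      intro a a' b b' h h'
      have := C.matching _ _ (hadj i) _ (e i a).2 _ (e i a').2 _ (e (i + 1) b).2 _
        (e (i + 1) b').2 h h'
      rwa [← Subtype.ext_iff, ← Subtype.ext_iff, (e i).apply_eq_iff_eq,
        (e (i + 1)).apply_eq_iff_eq] at this)
  choose σ hσ using hσ
  refine ⟨σ, ?_⟩
  have hcount : wheelCount σ = Fintype.card (Σ c, rimColorings σ c) := by
    simp [wheelCount, Fintype.card_sigma]
  rw [hcount]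
  have hhub : ∀ (x : Σ c, rimColorings σ c) i, ¬C.H.Adj (e₀ x.1).1 (e i (x.2.1 i).1).1 := by
    intro x i h
    exact (x.2.1 i).2 ((e i).injective (he i _ _ h)).symm
  have hrim : ∀ (x : Σ c, rimColorings σ c) i,
      ¬C.H.Adj (e i (x.2.1 i).1).1 (e (i + 1) (x.2.1 (i + 1)).1).1 := by
    intro x i h
    exact (Finset.mem_filter.1 x.2.2).2 i (hσ i _ _ h).symm
  refine card_le_numColorings C (fun x => Sum.rec (fun h => (e₀ x.1).1)
    fun i => (e i (x.2.1 i).1).1) ?_ ?_ ?_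
  · rintro ⟨c, a⟩ ⟨c', a'⟩ h
    obtain rfl : c = c' := e₀.injective (Subtype.ext (congrFun h (Sum.inl 0)))
    congr 1
    refine Subtype.ext (funext fun i => Subtype.ext ((e i).injective (Subtype.ext ?_)))
    exact congrFun h (Sum.inr i)
  · rintro x (h | i)
    · rw [Subsingleton.elim h 0]
      exact (e₀ x.1).2
    · exact (e i _).2
  · rintro x (h | i) (h' | j) huv hH
    · exact wheel_not_adj_inl _ _ huv
    · exact hhub x j hH
    · exact hhub x i hH.symm
    · rw [wheel_adj_rim, cycleGraph_adj_iff hl] at huv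
      rcases huv with rfl | rfl
      · exact hrim x i hH
      · exact hrim x j hH.symm

theorem chromaticPoly_wheel_le (hl : 1 ≤ l) :
    chromaticPoly (wheel (l + 1)) m ≤ wheelCount (1 : Fin (l + 1) → Equiv.Perm (Fin m)) := by
  have hcount : wheelCount (1 : Fin (l + 1) → Equiv.Perm (Fin m)) =
      Nat.card (Σ c, rimColorings (1 : Fin (l + 1) → Equiv.Perm (Fin m)) c) := by
    simp [wheelCount, Fintype.card_sigma]
  rw [hcount]
  refine Nat.card_le_card_of_injective (fun f => ⟨f (Sum.inl 0),
    ⟨fun i => ⟨f (Sum.inr i), fun h => f.valid (wheel_adj_hub i 0) h.symm⟩, ?_⟩⟩) ?_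
  · rw [rimColorings, Finset.mem_filter]
    exact ⟨Finset.mem_univ _, fun i h => f.valid
      (wheel_adj_rim.2 ((cycleGraph_adj_iff hl).2 (Or.inl (rfl : i + 1 = i + 1)))) h.symm⟩
  · intro f g h
    rw [Sigma.mk.injEq] at h
    obtain ⟨h0, h1⟩ := h
    refine DFunLike.ext _ _ ?_
    rintro (x | i)
    · rw [Subsingleton.elim x 0]
      exact h0
    · have : ∀ {c c' : Fin m} (_ : c = c')
        {a : rimColorings (1 : Fin (l + 1) → Equiv.Perm (Fin m)) c}
        {a' : rimColorings (1 : Fin (l + 1) → Equiv.Perm (Fin m)) c'},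
        HEq a a' → (a.1 i).1 = (a'.1 i).1 := by
        rintro c _ rfl a _ ⟨⟩
        rfl
      exact this h0 h1

theorem dpColorFunction_wheel_eq (hl : 1 ≤ l) (hm : 1 ≤ m)
    (h : ∀ σ : Fin (l + 1) → Equiv.Perm (Fin m),
      wheelCount (1 : Fin (l + 1) → Equiv.Perm (Fin m)) ≤ wheelCount σ) :
    dpColorFunction (wheel (l + 1)) m = chromaticPoly (wheel (l + 1)) m := by
  refine (dpColorFunction_le_chromaticPoly _ hm).antisymm ?_
  obtain ⟨C, hC, hC'⟩ := (isLeast_dpColorFunction (wheel (l + 1)) hm).1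
  obtain ⟨σ, hσ⟩ := exists_wheelCount_le hl C hC
  rw [← hC']
  exact (chromaticPoly_wheel_le hl).trans ((h σ).trans hσ)

theorem dpColorFunction_wheel_eq_zero (hl : 1 ≤ l) (hm : 1 ≤ m) (hm2 : m ≤ 2) :
    dpColorFunction (wheel (l + 1)) m = 0 := by
  refine Nat.le_zero.1 ((dpColorFunction_le_chromaticPoly _ hm).trans
    ((chromaticPoly_wheel_le hl).trans (Nat.cast_le (α := ℤ).1 ?_)))
  rw [wheelCount_one, Fintype.card_fin]
  interval_cases m <;> simp

theorem three_le_dpColorFunction_wheel (hl : Odd l) : 3 ≤ dpColorFunction (wheel (l + 1)) 3 := by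
  obtain ⟨C, hC, hC'⟩ := (isLeast_dpColorFunction (wheel (l + 1)) (by norm_num : 1 ≤ 3)).1
  obtain ⟨σ, hσ⟩ := exists_wheelCount_le hl.pos C hC
  rw [← hC']
  exact (three_le_wheelCount (by simp) hl σ).trans hσ

/-! ### The extremal 3-fold cover of an even rim -/

/-- The shift of three colors on the rim edge that joins the last vertex to the first. -/
def rimTwist (l : ℕ) : Fin 1 ⊕ Fin (l + 1) → Fin 1 ⊕ Fin (l + 1) → Equiv.Perm (Fin 3)
  | Sum.inr i, Sum.inr j =>
    if i = Fin.last l ∧ j = 0 then finRotate 3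
    else if i = 0 ∧ j = Fin.last l then (finRotate 3)⁻¹ else 1
  | _, _ => 1

theorem rimTwist_symm (hl : 1 ≤ l) (u v : Fin 1 ⊕ Fin (l + 1)) :
    rimTwist l v u = (rimTwist l u v)⁻¹ := by
  have h0 : Fin.last l ≠ 0 := by
    rw [Ne, Fin.ext_iff, Fin.val_last, Fin.val_zero]
    omega
  rcases u with u | i <;> rcases v with v | j <;> simp only [rimTwist, inv_one]
  by_cases h1 : i = Fin.last l ∧ j = 0
  · rw [if_pos h1, if_neg fun h => h0 (h1.1.symm.trans h.2), if_pos h1.symm]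
  · rw [if_neg h1]
    by_cases h2 : i = 0 ∧ j = Fin.last l
    · rw [if_pos h2, if_pos h2.symm, inv_inv]
    · rw [if_neg h2, if_neg fun h => h2 h.symm, if_neg fun h => h1 h.symm, inv_one]

theorem rimTwist_coloring_eq (hl : Odd l) (h1 : l ≠ 1) {f : Fin 1 ⊕ Fin (l + 1) → Fin 3}
    (hf : ∀ u v, (wheel (l + 1)).Adj u v → f v ≠ rimTwist l u v (f u)) (j : Fin (l + 1)) :
    f (Sum.inr j) = if Even j.val then f (Sum.inl 0) + 1 else f (Sum.inl 0) + 2 := by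
  have hhub : ∀ i, f (Sum.inr i) ≠ f (Sum.inl 0) := fun i => hf _ _ (wheel_adj_hub i 0)
  have hstep : ∀ i : Fin l, f (Sum.inr i.succ) ≠ f (Sum.inr i.castSucc) := by
    intro i
    have := hf (Sum.inr i.castSucc) (Sum.inr i.succ)
      (wheel_adj_rim.2 ((cycleGraph_adj_iff hl.pos).2 (Or.inl Fin.coeSucc_eq_succ.symm)))
    have ht : rimTwist l (Sum.inr i.castSucc) (Sum.inr i.succ) = 1 := by
      simp only [rimTwist]
      rw [if_neg fun h => Fin.succ_ne_zero _ h.2, if_neg]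
      rintro ⟨h2, h3⟩
      rw [Fin.ext_iff] at h2 h3
      simp only [Fin.val_castSucc, Fin.val_succ, Fin.val_last, Fin.val_zero] at h2 h3
      omega
    rwa [ht] at this
  have hlast : f (Sum.inr 0) ≠ finRotate 3 (f (Sum.inr (Fin.last l))) := by
    have := hf (Sum.inr (Fin.last l)) (Sum.inr 0)
      (wheel_adj_rim.2 ((cycleGraph_adj_iff hl.pos).2 (Or.inl (Fin.last_add_one l).symm)))
    simpa only [rimTwist, and_self, if_true] using this
  -- The three colors sum to zero modulo 3, so `-c - x` is the third one: the rim must alternate.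
  have halt : ∀ x y c : Fin 3, x ≠ c → y ≠ c → y ≠ x → y = -c - x := by decide
  have hall : ∀ j : Fin (l + 1), f (Sum.inr j) =
      if Even j.val then f (Sum.inr 0) else -f (Sum.inl 0) - f (Sum.inr 0) := by
    intro j
    induction j using Fin.induction with
    | zero => simp
    | succ i ih =>
      rw [halt _ _ _ (hhub _) (hhub _) (hstep i), ih]
      simp only [Fin.val_castSucc, Fin.val_succ, Nat.even_add_one]
      split_ifs
      · rfl
      · abel
  have hend := hall (Fin.last l)
  rw [Fin.val_last, if_neg (Nat.not_even_iff_odd.2 hl)] at hend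
  -- The twisted edge rejects `x = c + 2`, so the hub color determines the whole coloring.
  have hdec : ∀ c x : Fin 3, x ≠ c → x ≠ finRotate 3 (-c - x) → x = c + 1 := by decide
  rw [hend] at hlast
  have h0 := hdec _ _ (hhub 0) hlast
  have hfin : ∀ c : Fin 3, -c - (c + 1) = c + 2 := by decide
  rw [hall j, h0, hfin]

theorem dpColorFunction_wheel_three (hl : Odd l) (h1 : l ≠ 1) :
    dpColorFunction (wheel (l + 1)) 3 = 3 := by
  refine le_antisymm ?_ (three_le_dpColorFunction_wheel hl)
  refine (dpColorFunction_le_card _ (rimTwist l) (rimTwist_symm hl.pos) (by norm_num)).trans ?_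
  refine (Nat.card_le_card_of_injective (β := Fin 3) (fun f => f.1 (Sum.inl 0)) ?_).trans
    (by simp)
  intro f g h
  refine Subtype.ext (funext ?_)
  rintro (x | j)
  · rw [Subsingleton.elim x 0]
    exact h
  · rw [rimTwist_coloring_eq hl h1 f.2, rimTwist_coloring_eq hl h1 g.2,
      show f.1 (Sum.inl 0) = g.1 (Sum.inl 0) from h]

end Wheel
end DPColor

theorem mainTheorem2 (k m : ℕ) (hk : 1 ≤ k) (hm : 1 ≤ m) :
    DPColor.dpColorFunction (DPColor.wheel (2 * k + 1)) m =
        DPColor.chromaticPoly (DPColor.wheel (2 * k + 1)) m ∧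
      (m ≤ 2 → DPColor.dpColorFunction (DPColor.wheel (2 * k + 2)) m = 0) ∧
      (m = 3 → DPColor.dpColorFunction (DPColor.wheel (2 * k + 2)) m = 3) ∧
      (4 ≤ m → DPColor.dpColorFunction (DPColor.wheel (2 * k + 2)) m =
        DPColor.chromaticPoly (DPColor.wheel (2 * k + 2)) m) := by
  refine ⟨?_, fun hm2 => ?_, ?_, fun hm4 => ?_⟩
  · exact DPColor.dpColorFunction_wheel_eq (by omega) hm
      (DPColor.wheelCount_one_le_of_even (even_two_mul k))
  · exact DPColor.dpColorFunction_wheel_eq_zero (l := 2 * k + 1) (by omega) hm hm2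
  · rintro rfl
    exact DPColor.dpColorFunction_wheel_three (odd_two_mul_add_one k) (by omega)
  · exact DPColor.dpColorFunction_wheel_eq (l := 2 * k + 1) (by omega) hm
      (DPColor.wheelCount_one_le_of_odd (by simpa using hm4) (odd_two_mul_add_one k) (by omega))
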